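/- Let $n,m,K,T$ be nonnegative integers. Consider a system with state $x_t\in\mathbf R^n$, mode $s_t\in\{1,\dots,K\}$ and input $u_t\in\mathbf R^m$, with $$x_{t+1}=A_t^{s_t}(w_t)x_t+B_t^{s_t}(w_t)u_t+c_t^{s_t}(w_t),\qquad s_{t+1}=i\ \text{ with probability } \Pi_{t,ij}\ \text{ if } s_t=j,$$ for $t=0,\dots,T-1$, where the disturbances $w_t$ are independent random elements of measurable spaces $\mathcal W_t$, the mode switching is Markov and independent of the disturbances, and $A_t^s,B_t^s,c_t^s$ are measurable. The stage and final costs are $$g_t^s(x,u,w)=\tfrac12\begin{bmatrix}x\\u\\1\end{bmatrix}^{T}G_t^s(w)\begin{bmatrix}x\\u\\1\end{bmatrix}+\begin{cases}0& F_t^sx+H_t^su+h_t^s=0\\+\infty&\text{otherwise}\end{cases},\qquad g_T^s(x)=\tfrac12\begin{bmatrix}x\\1\end{bmatrix}^{T}G_T^s\begin{bmatrix}x\\1\end{bmatrix}+\begin{cases}0& F_T^sx+h_T^s=0\\+\infty&\text{otherwise}\end{cases},$$ with symmetric $G_t^s(w)$ (measurable in $w$) and $G_T^s$. A policy sequence consists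 of measurable maps $\phi_\tau^s:\mathbf R^n\to\mathbf R^m$, used as $u_\tau=\phi_\tau^{s_\tau}(x_\tau)$. Its total cost from time $t$, mode $s$ and state $x$ is the random variable $\sum_{\tau=t}^{T-1}g_\tau^{s_\tau}(x_\tau,u_\tau,w_\tau)+g_T^{s_T}(x_T)$ with $x_t=x$, $s_t=s$; its expectation exists if the positive and negative parts do not both have infinite expectation, and is then an element of $[-\infty,+\infty]$. The cost-to-go $V_t^s(x)\in[-\infty,+\infty]$ is the infimum of the expected total cost over all policy sequences for which this expectation exists. Assume that the following pathologies are absent, for all $0\le t\le T$, all $s$ and all $x$: (i) undefined cost: the expected total cost from $(t,s,x)$ exists for every affine policy sequence $\phi_\tau^\sigma(x)=K_\tau^\sigma x+k_\tau^\sigma$; (ii) cost that is unbounded below: $V_t^s(x)>-\infty$. Then for all $0\le t\le T$ and all $s$ the function $V_t^s$ is extended quadratic, i.e. there are a symmetric matrix $P$, a vector $q$, a number $r$, and a matrix $F$ and vector $g$ (possibly with no rows) with $$V_t^s(x)=\tfrac12\begin{bmatrix}x\\1\end{bmatrix}^{T}\begin{bmatrix}P&q\\q^T&r\end{bmatrix}\begin{bmatrix}x\\1\end{bmatrix}+\begin{cases}0&Fx+g=0\\+\infty&\text{otherwise}\end{cases}\qquad\text{for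 all }x\in\mathbf R^n .$$ Moreover there are matrices $K_t^s\in\mathbf R^{m\times n}$ and vectors $k_t^s\in\mathbf R^m$ such that the affine policy sequence $\phi_t^s(x)=K_t^sx+k_t^s$ is optimal: for every $0\le t\le T$, $s$ and $x$, its expected total cost from $(t,s,x)$ exists and equals $V_t^s(x)$. -/

import Mathlib

open MeasureTheory Matrix
open scoped ENNReal

noncomputable section

/-! ### Extended quadratic functions -/

/-- The vector `(z, 1)`. -/
def appendOne {ι : Type*} (z : ι → ℝ) : ι ⊕ Unit → ℝ :=
  Sum.elim z (fun _ => 1)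

open Classical in
/-- The function `z ↦ (1/2) (z, 1)ᵀ M (z, 1)` plus the indicator function (`0` or `+∞`) of the
linear equality constraint `F z + g = 0`. With zero rows in `F` there is no constraint. -/
def extQuad {ι : Type*} [Fintype ι] {p : ℕ} (M : Matrix (ι ⊕ Unit) (ι ⊕ Unit) ℝ)
    (F : Matrix (Fin p) ι ℝ) (g : Fin p → ℝ) (z : ι → ℝ) : EReal :=
  if F *ᵥ z + g = 0 then (((1 / 2 : ℝ) * (appendOne z ⬝ᵥ M *ᵥ appendOne z) : ℝ) : EReal) else ⊤

/-- Extended quadratic functions `ℝⁿ → ℝ ∪ {+∞}` with coefficients `P` (symmetric), `q`, `r`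
and constraint `F x + g = 0`. -/
def IsExtendedQuadratic {n : ℕ} (f : (Fin n → ℝ) → EReal) : Prop :=
  ∃ (P : Matrix (Fin n) (Fin n) ℝ) (q : Fin n → ℝ) (r : ℝ) (p : ℕ)
    (F : Matrix (Fin p) (Fin n) ℝ) (g : Fin p → ℝ), P.IsSymm ∧
    ∀ x, f x = extQuad
      (fromBlocks P (replicateCol Unit q) (replicateRow Unit q) (fun _ _ => r)) F g x

/-! ### Expectation of extended-real-valued random variables -/

/-- The expectation of `X` exists: the positive and the negative part of `X` do not both have
infinite expectation. -/
def ExpectationExists {Ω : Type*} [MeasurableSpace Ω] (ℙ : Measure Ω) (X : Ω → EReal) : Prop :=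
  ∫⁻ ω, (X ω).toENNReal ∂ℙ ≠ ∞ ∨ ∫⁻ ω, (-X ω).toENNReal ∂ℙ ≠ ∞

/-- The expectation of `X`, with values in `[-∞, +∞]`; it is meant to be used only when
`ExpectationExists ℙ X` holds. -/
def expectation {Ω : Type*} [MeasurableSpace Ω] (ℙ : Measure Ω) (X : Ω → EReal) : EReal :=
  ((∫⁻ ω, (X ω).toENNReal ∂ℙ : ℝ≥0∞) : EReal) - ((∫⁻ ω, (-X ω).toENNReal ∂ℙ : ℝ≥0∞) : EReal)

/-! ### The control problem -/

/-- The data of a finite-horizon extended quadratic control problem: states in `ℝⁿ`, inputs in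
`ℝᵐ`, modes `Fin K`, disturbances `w_t` in a probability space `W t`. Only the data at times
`t < horizon` (and the final cost) matter. -/
structure ExtQuadControl (n m K : ℕ) (W : ℕ → Type*) [∀ t, MeasurableSpace (W t)] where
  horizon : ℕ
  /-- the distribution of `w_t` -/
  dist : ∀ t, Measure (W t)
  isProb : ∀ t, IsProbabilityMeasure (dist t)
  /-- `modeProb t i j` is the probability of `s_{t+1} = i` given `s_t = j` -/
  modeProb : ℕ → Matrix (Fin K) (Fin K) ℝ
  modeProb_nonneg : ∀ t i j, 0 ≤ modeProb t i j
  modeProb_sum : ∀ t j, ∑ i, modeProb t i j = 1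
  /-- dynamics `x_{t+1} = A x + B u + c` -/
  A : (t : ℕ) → Fin K → W t → Matrix (Fin n) (Fin n) ℝ
  B : (t : ℕ) → Fin K → W t → Matrix (Fin n) (Fin m) ℝ
  c : (t : ℕ) → Fin K → W t → Fin n → ℝ
  measurable_A : ∀ t s i j, Measurable fun w => A t s w i j
  measurable_B : ∀ t s i j, Measurable fun w => B t s w i j
  measurable_c : ∀ t s i, Measurable fun w => c t s w i
  /-- random quadratic part of the stage costs -/
  G : (t : ℕ) → Fin K → W t →
    Matrix ((Fin n ⊕ Fin m) ⊕ Unit) ((Fin n ⊕ Fin m) ⊕ Unit) ℝ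
  G_symm : ∀ t s w, (G t s w).IsSymm
  measurable_G : ∀ t s i j, Measurable fun w => G t s w i j
  /-- deterministic constraints `F x + H u + h = 0` of the stage costs -/
  p : ℕ → Fin K → ℕ
  F : (t : ℕ) → (s : Fin K) → Matrix (Fin (p t s)) (Fin n) ℝ
  H : (t : ℕ) → (s : Fin K) → Matrix (Fin (p t s)) (Fin m) ℝ
  h : (t : ℕ) → (s : Fin K) → Fin (p t s) → ℝ
  /-- final cost -/
  Gfinal : Fin K → Matrix (Fin n ⊕ Unit) (Fin n ⊕ Unit) ℝ
  Gfinal_symm : ∀ s, (Gfinal s).IsSymm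
  pfinal : Fin K → ℕ
  Ffinal : (s : Fin K) → Matrix (Fin (pfinal s)) (Fin n) ℝ
  hfinal : (s : Fin K) → Fin (pfinal s) → ℝ

/-- A sequence of policies: `φ t s x` is the input applied at time `t` in mode `s` and state `x`. -/
abbrev PolicySeq (n m K : ℕ) := ℕ → Fin K → (Fin n → ℝ) → (Fin m → ℝ)

/-- The affine policies `φ_t^s(x) = K_t^s x + k_t^s`. -/
def affinePolicy {n m K : ℕ} (gain : ℕ → Fin K → Matrix (Fin m) (Fin n) ℝ)
    (offset : ℕ → Fin K → Fin m → ℝ) : PolicySeq n m K :=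
  fun t s x => gain t s *ᵥ x + offset t s

namespace ExtQuadControl

variable {n m K : ℕ} {W : ℕ → Type*} [∀ t, MeasurableSpace (W t)]

/-- The state transition function `f_t^s(x, u, w)`. -/
def dyn (C : ExtQuadControl n m K W) (t : ℕ) (s : Fin K) (x : Fin n → ℝ) (u : Fin m → ℝ)
    (w : W t) : Fin n → ℝ :=
  C.A t s w *ᵥ x + C.B t s w *ᵥ u + C.c t s w

/-- The stage cost `g_t^s(x, u, w)`. -/
def stageCost (C : ExtQuadControl n m K W) (t : ℕ) (s : Fin K) (x : Fin n → ℝ) (u : Fin m → ℝ)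
    (w : W t) : EReal :=
  extQuad (C.G t s w) (fromCols (C.F t s) (C.H t s)) (C.h t s) (Sum.elim x u)

/-- The final stage cost `g_T^s(x)`. -/
def finalCost (C : ExtQuadControl n m K W) (s : Fin K) (x : Fin n → ℝ) : EReal :=
  extQuad (C.Gfinal s) (C.Ffinal s) (C.hfinal s) x

/-- The distribution of the next mode, when the mode at time `t` is `j`. -/
def nextMode (C : ExtQuadControl n m K W) (t : ℕ) (j : Fin K) : PMF (Fin K) :=
  PMF.ofFintype (fun i => ENNReal.ofReal (C.modeProb t i j)) (by
    rw [← ENNReal.ofReal_sum_of_nonneg (fun i _ => C.modeProb_nonneg t i j), C.modeProb_sum,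
      ENNReal.ofReal_one])

/-- The joint law of all the randomness. At time `t` the randomness is a pair `(w_t, ξ_t)` of the
disturbance `w_t` and a random map `ξ_t` of the modes, independent of `w_t`, with `ξ_t j`
distributed as the next mode after `j`; the pairs are independent in time. The mode then evolves
as `s_{t+1} = ξ_t s_t`, which makes it a Markov chain with the given switching probabilities,
independent of the disturbances. -/
def law (C : ExtQuadControl n m K W) : Measure ((t : ℕ) → W t × (Fin K → Fin K)) :=
  Measure.infinitePi fun t => (C.dist t).prod (Measure.pi fun j => (C.nextMode t j).toMeasure)

instance (C : ExtQuadControl n m K W) : IsProbabilityMeasure C.law := by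
  have := C.isProb
  unfold law
  infer_instance

/-- State and mode at time `t + k` under the policies `φ`, when they are `x` and `s` at
time `t`. -/
def traj (C : ExtQuadControl n m K W) (φ : PolicySeq n m K) (t : ℕ) (s : Fin K) (x : Fin n → ℝ)
    (ω : (t : ℕ) → W t × (Fin K → Fin K)) : ℕ → (Fin n → ℝ) × Fin K
  | 0 => (x, s)
  | k + 1 =>
    let y := traj C φ t s x ω k
    (C.dyn (t + k) y.2 y.1 (φ (t + k) y.2 y.1) (ω (t + k)).1, (ω (t + k)).2 y.2)

/-- The (random) total cost from time `t` to the horizon `T` under the policies `φ`, starting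
from state `x` and mode `s` at time `t`. -/
def totalCost (C : ExtQuadControl n m K W) (φ : PolicySeq n m K) (t : ℕ) (s : Fin K)
    (x : Fin n → ℝ) (ω : (t : ℕ) → W t × (Fin K → Fin K)) : EReal :=
  (∑ k ∈ Finset.range (C.horizon - t),
      C.stageCost (t + k) (C.traj φ t s x ω k).2 (C.traj φ t s x ω k).1
        (φ (t + k) (C.traj φ t s x ω k).2 (C.traj φ t s x ω k).1) (ω (t + k)).1)
    + C.finalCost (C.traj φ t s x ω (C.horizon - t)).2 (C.traj φ t s x ω (C.horizon - t)).1

/-- The policies are measurable, and their expected total cost from `x`, `s` at time `t` exists. -/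
def IsAdmissible (C : ExtQuadControl n m K W) (t : ℕ) (s : Fin K) (x : Fin n → ℝ)
    (φ : PolicySeq n m K) : Prop :=
  (∀ τ σ, Measurable (φ τ σ)) ∧ ExpectationExists C.law (C.totalCost φ t s x)

/-- The expected total cost from `x`, `s` at time `t`. -/
def expectedCost (C : ExtQuadControl n m K W) (φ : PolicySeq n m K) (t : ℕ) (s : Fin K)
    (x : Fin n → ℝ) : EReal :=
  expectation C.law (C.totalCost φ t s x)

/-- The cost-to-go function `V_t^s(x)`: the infimum of the expected total cost over all policies
for which it exists. -/
def costToGo (C : ExtQuadControl n m K W) (t : ℕ) (s : Fin K) (x : Fin n → ℝ) : EReal :=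
  ⨅ (φ : PolicySeq n m K) (_ : C.IsAdmissible t s x φ), C.expectedCost φ t s x

/-- `φ` is optimal: from every time, mode and state it is admissible and attains the
cost-to-go. -/
def IsOptimal (C : ExtQuadControl n m K W) (φ : PolicySeq n m K) : Prop :=
  ∀ t ≤ C.horizon, ∀ s x, C.IsAdmissible t s x φ ∧ C.expectedCost φ t s x = C.costToGo t s x

end ExtQuadControl

end

/-! ### Coordinate-free extended quadratic functions -/

/-! Dynamic programming, run over affine policies instead of through a Bellman equation, so no
measurable selection is needed. Suppose affine policies attain the cost-to-go at time `t + 1`. Apply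
a constant input `u` at time `t` from state `x`, follow those policies afterwards, and let `J(x, u)`
be the expected cost. Three facts finish the step.

For each outcome the cost is an extended quadratic function of `(x, u)`. Its expectation is again
extended quadratic (`IsExtQuad.expectation`): the points of finite expectation form an affine
subspace, on which the coefficients can be integrated. Existence of the expectations comes from (i),
since constant inputs are affine policies. They are not `⊥` by (ii), since `J(x, u)` is at least the
cost-to-go.

By the same bound `J(x, ·)` is bounded below, so its minimum is attained at an affine function of
`x` (`IsExtQuad.exists_affine_argmin`): stationarity is an affine condition, and an affine subspace
of a product has an affine section.

Finally, an admissible `φ` costs at least `J(x, φ_t(x))` (`expectedCost_le_of_tail`): with the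
randomness of time `t` frozen, the stage cost is a constant and the affine tail is no worse than
that of `φ`. The tail of `φ` need not have an expectation from every successor state; only outcomes
whose conditional positive and negative parts are both finite have to be compared, and these are
almost all when `φ` has finite expected cost. -/

/-- Functions that agree with a quadratic polynomial on an affine subspace and are `+∞` off it. -/
def IsExtQuad {E : Type*} [AddCommGroup E] [Module ℝ E] (f : E → EReal) : Prop :=
  ∃ (D : AffineSubspace ℝ E) (b : E →ₗ[ℝ] E →ₗ[ℝ] ℝ) (l : E →ₗ[ℝ] ℝ) (r : ℝ),
    (∀ z ∈ D, f z = ((b z z + l z + r : ℝ) : EReal)) ∧ ∀ z ∉ D, f z = ⊤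

namespace IsExtQuad

variable {E E' : Type*} [AddCommGroup E] [Module ℝ E] [AddCommGroup E'] [Module ℝ E']

theorem ne_bot {f : E → EReal} (hf : IsExtQuad f) (z : E) : f z ≠ ⊥ := by
  obtain ⟨D, b, l, r, h1, h2⟩ := hf
  by_cases hz : z ∈ D
  · rw [h1 z hz]; exact EReal.coe_ne_bot _
  · rw [h2 z hz]; exact top_ne_bot

theorem add {f g : E → EReal} (hf : IsExtQuad f) (hg : IsExtQuad g) :
    IsExtQuad fun z => f z + g z := by
  have hfb := hf.ne_bot
  have hgb := hg.ne_bot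
  obtain ⟨D, b, l, r, h1, h2⟩ := hf
  obtain ⟨D', b', l', r', h1', h2'⟩ := hg
  refine ⟨D ⊓ D', b + b', l + l', r + r', fun z hz => ?_, fun z hz => ?_⟩
  · obtain ⟨hz, hz'⟩ := (AffineSubspace.mem_inf_iff _ _ _).1 hz
    change f z + g z = _
    rw [h1 z hz, h1' z hz', ← EReal.coe_add]
    simp only [LinearMap.add_apply]
    congr 1
    ring
  · rw [AffineSubspace.mem_inf_iff, not_and_or] at hz
    change f z + g z = _
    rcases hz with hz | hz
    · rw [h2 z hz, EReal.top_add_of_ne_bot (hgb z)]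
    · rw [h2' z hz, EReal.add_top_of_ne_bot (hfb z)]

theorem comp_affine {f : E → EReal} (hf : IsExtQuad f) (L : E' →ₗ[ℝ] E) (k : E) :
    IsExtQuad fun z => f (L z + k) := by
  obtain ⟨D, b, l, r, h1, h2⟩ := hf
  let A : E' →ᵃ[ℝ] E := ⟨fun z => L z + k, L, fun p v => by
    simp only [vadd_eq_add, map_add]; abel⟩
  refine ⟨D.comap A, b.compl₁₂ L L, l ∘ₗ L + b k ∘ₗ L + b.flip k ∘ₗ L, r + b k k + l k,
    fun z hz => ?_, fun z hz => ?_⟩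
  · change f (L z + k) = _
    rw [h1 (L z + k) hz]
    simp only [map_add, LinearMap.add_apply, LinearMap.compl₁₂_apply, LinearMap.comp_apply,
      LinearMap.flip_apply]
    congr 1
    ring
  · exact h2 _ hz

/-- Since `z ↦ (z, 1)` is affine, it is enough to treat a homogeneous quadratic form on `ι ⊕ Unit →
ℝ`, restricted to an affine subspace. -/
theorem extQuad {ι : Type*} [Fintype ι] {p : ℕ} (M : Matrix (ι ⊕ Unit) (ι ⊕ Unit) ℝ)
    (F : Matrix (Fin p) ι ℝ) (g : Fin p → ℝ) : IsExtQuad (extQuad M F g) := by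
  classical
  let J : (ι → ℝ) →ₗ[ℝ] (ι ⊕ Unit → ℝ) :=
    { toFun := fun z => Sum.elim z 0
      map_add' := fun x y => by ext (i | i) <;> simp
      map_smul' := fun c x => by ext (i | i) <;> simp }
  let D : AffineSubspace ℝ (ι ⊕ Unit → ℝ) :=
    { carrier := {y | F *ᵥ (y ∘ Sum.inl) + g = 0}
      smul_vsub_vadd_mem' := fun c p₁ p₂ p₃ h₁ h₂ h₃ => by
        have e : (c • (p₁ -ᵥ p₂) +ᵥ p₃) ∘ Sum.inl
            = c • (p₁ ∘ Sum.inl - p₂ ∘ Sum.inl) + p₃ ∘ Sum.inl := rfl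
        simp only [Set.mem_ofPred_eq] at h₁ h₂ h₃ ⊢
        rw [e, mulVec_add, mulVec_smul, mulVec_sub, eq_neg_of_add_eq_zero_left h₁,
          eq_neg_of_add_eq_zero_left h₂, eq_neg_of_add_eq_zero_left h₃]
        simp }
  have key : IsExtQuad fun y : ι ⊕ Unit → ℝ =>
      if F *ᵥ (y ∘ Sum.inl) + g = 0 then (((1 / 2 : ℝ) * (y ⬝ᵥ M *ᵥ y) : ℝ) : EReal) else ⊤ := by
    refine ⟨D, Matrix.toLinearMap₂' ℝ ((1 / 2 : ℝ) • M), 0, 0, fun y hy => ?_, fun y hy => ?_⟩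
    · refine (if_pos (show F *ᵥ (y ∘ Sum.inl) + g = 0 from hy)).trans ?_
      rw [Matrix.toLinearMap₂'_apply']
      simp [smul_mulVec]
    · exact if_neg (show ¬ F *ᵥ (y ∘ Sum.inl) + g = 0 from hy)
  have h := key.comp_affine J (Sum.elim (0 : ι → ℝ) (1 : Unit → ℝ))
  convert h using 2 with z
  have hz : J z + Sum.elim (0 : ι → ℝ) (1 : Unit → ℝ) = appendOne z := by
    ext (i | i) <;> simp [J, appendOne]
  have hz' : (appendOne z) ∘ Sum.inl = z := by ext i; simp [appendOne]
  rw [hz, hz']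
  unfold _root_.extQuad
  congr

theorem isExtendedQuadratic {n : ℕ} {f : (Fin n → ℝ) → EReal} (hf : IsExtQuad f) :
    IsExtendedQuadratic f := by
  classical
  obtain ⟨D, b, l, r, h1, h2⟩ := hf
  obtain ⟨p, F, g, hD⟩ : ∃ (p : ℕ) (F : Matrix (Fin p) (Fin n) ℝ) (g : Fin p → ℝ),
      ∀ z, z ∈ D ↔ F *ᵥ z + g = 0 := by
    rcases (D : Set (Fin n → ℝ)).eq_empty_or_nonempty with hD | ⟨z₀, hz₀⟩
    -- An empty domain is encoded by the single inconsistent row `0 + 1 = 0`.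
    · refine ⟨1, 0, 1, fun z => ?_⟩
      have : z ∉ D := fun h => (Set.eq_empty_iff_forall_notMem.1 hD z) h
      simp [this]
    -- Coordinates of the quotient by the direction give the rows of the constraint.
    · let B := Module.finBasis ℝ ((Fin n → ℝ) ⧸ D.direction)
      let L := B.equivFun.toLinearMap ∘ₗ D.direction.mkQ
      refine ⟨_, LinearMap.toMatrix' L, - L z₀, fun z => ?_⟩
      rw [← Matrix.toLin'_apply, Matrix.toLin'_toMatrix', ← sub_eq_add_neg, ← map_sub,
        ← AffineSubspace.vsub_right_mem_direction_iff_mem (p := z₀) hz₀]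
      simp only [L, LinearMap.comp_apply, LinearEquiv.coe_coe, LinearEquiv.map_eq_zero_iff,
        Submodule.mkQ_apply, Submodule.Quotient.mk_eq_zero, vsub_eq_sub]
  let N := LinearMap.toMatrix₂' ℝ b
  -- The form `b` need not be symmetric; the prefactor `1/2` makes its symmetrization exactly `N +
  -- Nᵀ` and doubles the constant.
  refine ⟨N + Nᵀ, fun i => l (Pi.single i 1), 2 * r, p, F, g, ?_, fun z => ?_⟩
  · rw [Matrix.IsSymm, transpose_add, transpose_transpose, add_comm]
  · unfold _root_.extQuad
    by_cases hz : z ∈ D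
    · rw [if_pos ((hD z).1 hz), h1 z hz]
      congr 1
      have hb : b z z = z ⬝ᵥ N *ᵥ z := by
        rw [← Matrix.toLinearMap₂'_apply', Matrix.toLinearMap₂'_toMatrix']
      have hl : l z = ∑ i, z i * l (Pi.single i 1) := by
        conv_lhs => rw [← LinearMap.sum_single_apply (fun _ => ℝ) z, map_sum]
        refine Finset.sum_congr rfl fun i _ => ?_
        have : Pi.single i (z i) = z i • (Pi.single i (1 : ℝ) : Fin n → ℝ) := by
          rw [← Pi.single_smul]; simp
        rw [this, map_smul, smul_eq_mul]
      have ht : z ⬝ᵥ Nᵀ *ᵥ z = z ⬝ᵥ N *ᵥ z := by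
        rw [mulVec_transpose, dotProduct_comm, dotProduct_mulVec]
      have hs : appendOne z = Sum.elim z 1 := rfl
      suffices h : ∀ d : Matrix Unit Unit ℝ, d () () = 2 * r → b z z + l z + r =
          1 / 2 * (appendOne z ⬝ᵥ fromBlocks (N + Nᵀ) (replicateCol Unit fun i => l (Pi.single i 1))
            (replicateRow Unit fun i => l (Pi.single i 1)) d *ᵥ appendOne z) from h _ rfl
      intro d hd
      rw [hs, fromBlocks_mulVec, Sum.elim_comp_inl, Sum.elim_comp_inr, sumElim_dotProduct_sumElim,
        add_mulVec, dotProduct_add, dotProduct_add, ht, hb, hl]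
      simp only [dotProduct, mulVec, replicateCol_apply, replicateRow_apply, Pi.one_apply,
        Finset.univ_unique, Finset.sum_singleton, Pi.add_apply, one_mul, mul_one]
      rw [Finset.sum_congr rfl fun i _ => mul_comm (l (Pi.single i 1)) (z i), hd]
      ring
    · rw [if_neg (fun h => hz ((hD z).2 h)), h2 z hz]

end IsExtQuad

/-! ### Partial minimization of extended quadratic functions -/

/-- A quadratic polynomial in one variable that is bounded below has nonnegative leading
coefficient, and vanishing linear coefficient if the leading one vanishes. -/
theorem quadratic_bddBelow {a b m : ℝ} (h : ∀ t : ℝ, m ≤ b * t + a * t ^ 2) :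
    0 ≤ a ∧ (a = 0 → b = 0) := by
  constructor
  · by_contra! ha
    -- `m ≤ 0` makes `(m - 1) / a` nonnegative. At plus and minus its square root the quadratic term
    -- is `m - 1`; adding the two bounds cancels the linear terms and gives `2 m ≤ 2 (m - 1)`.
    have h0 := h 0
    have hs := Real.sq_sqrt (show (0 : ℝ) ≤ (m - 1) / a from
      div_nonneg_of_nonpos (by linarith) ha.le)
    have h1 := h (√((m - 1) / a))
    have h2 := h (-√((m - 1) / a))
    rw [neg_sq] at h2
    rw [hs, mul_div_cancel₀ _ ha.ne] at h1 h2
    linarith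
  · rintro rfl
    by_contra hb
    have h1 := h ((m - 1) / b)
    rw [mul_div_cancel₀ _ hb] at h1
    linarith

/-- A linear functional is the gradient of a quadratic form as soon as their sum is bounded
below. -/
theorem exists_stationary_of_bddBelow {N : Type*} [AddCommGroup N] [Module ℝ N]
    [FiniteDimensional ℝ N] (b : N →ₗ[ℝ] N →ₗ[ℝ] ℝ) (l : N →ₗ[ℝ] ℝ) (m : ℝ)
    (h : ∀ v, m ≤ b v v + l v) : ∃ v, ∀ w, b v w + b w v + l w = 0 := by
  have hline : ∀ v, 0 ≤ b v v ∧ (b v v = 0 → l v = 0) := fun v =>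
    quadratic_bddBelow (m := m) fun t => by
      have := h (t • v)
      simp only [map_smul, LinearMap.smul_apply, smul_eq_mul] at this
      linarith
  let β : N →ₗ[ℝ] N →ₗ[ℝ] ℝ := b + b.flip
  have hflip : β.flip = β := by
    ext v w; simp [β, add_comm]
  -- In finite dimension the range of the symmetric form `β` is the annihilator of its kernel, and
  -- `l` vanishes on the kernel because `b v v = 0` there.
  have hl : -l ∈ LinearMap.range β := by
    rw [← hflip, ← LinearMap.dualAnnihilator_ker_eq_range_flip, Submodule.mem_dualAnnihilator]
    intro v hv
    have h1 : β v v = 0 := by rw [LinearMap.mem_ker.1 hv]; rfl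
    have h2 : b v v = 0 := by
      simp only [β, LinearMap.add_apply, LinearMap.flip_apply] at h1; linarith
    simp [(hline v).2 h2]
  obtain ⟨v, hv⟩ := hl
  refine ⟨v, fun w => ?_⟩
  have := LinearMap.congr_fun hv w
  simp only [β, LinearMap.add_apply, LinearMap.flip_apply, LinearMap.neg_apply] at this
  linarith

/-- An affine subspace of a product contains the graph of an affine map over its projection. -/
theorem AffineSubspace.exists_affine_section {E U : Type*} [AddCommGroup E] [Module ℝ E]
    [AddCommGroup U] [Module ℝ U] (O : AffineSubspace ℝ (E × U)) :
    ∃ (L : E →ₗ[ℝ] U) (k : U), ∀ x u, (x, u) ∈ O → (x, L x + k) ∈ O := by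
  rcases (O : Set (E × U)).eq_empty_or_nonempty with hO | ⟨⟨x₀, u₀⟩, h₀⟩
  · exact ⟨0, 0, fun x u hx => ((Set.eq_empty_iff_forall_notMem.1 hO _) hx).elim⟩
  · let f : O.direction →ₗ[ℝ] E := LinearMap.fst ℝ E U ∘ₗ O.direction.subtype
    -- Split the projection of the direction onto its image in `E`, then extend the `U`-component of
    -- the splitting linearly to all of `E`.
    obtain ⟨g, hg⟩ := f.rangeRestrict.exists_rightInverse_of_surjective f.range_rangeRestrict
    obtain ⟨L, hL⟩ := LinearMap.exists_extend
      (LinearMap.snd ℝ E U ∘ₗ O.direction.subtype ∘ₗ g)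
    refine ⟨L, u₀ - L x₀, fun x u hx => ?_⟩
    have hd : (x, u) -ᵥ (x₀, u₀) ∈ O.direction := AffineSubspace.vsub_mem_direction hx h₀
    let y : LinearMap.range f := ⟨x - x₀, ⟨_, hd⟩, rfl⟩
    have h1 : (g y : E × U).1 = x - x₀ := congrArg Subtype.val (LinearMap.congr_fun hg y)
    have h2 : (g y : E × U).2 = L (x - x₀) := (LinearMap.congr_fun hL y).symm
    have h3 := AffineSubspace.vadd_mem_of_mem_direction (g y).2 h₀
    convert h3 using 1
    ext
    · simp [h1]
    · simp only [vadd_eq_add, Prod.snd_add, h2, map_sub]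
      abel

/-- Partial minimization: if an extended quadratic function of `(x, u)` is bounded below in `u`
for all `x`, then its minimum over `u` is attained at an affine function of `x`. -/
theorem IsExtQuad.exists_affine_argmin {E U : Type*} [AddCommGroup E] [Module ℝ E]
    [AddCommGroup U] [Module ℝ U] [FiniteDimensional ℝ U] {f : E × U → EReal} (hf : IsExtQuad f)
    (hbdd : ∀ x, ∃ m : ℝ, ∀ u, (m : EReal) ≤ f (x, u)) :
    ∃ (L : E →ₗ[ℝ] U) (k : U), ∀ x u, f (x, L x + k) ≤ f (x, u) := by
  obtain ⟨D, b, l, r, h1, h2⟩ := hf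
  let inr := LinearMap.inr ℝ E U
  let N : Submodule ℝ U := D.direction.comap inr
  let i : N →ₗ[ℝ] E × U := inr ∘ₗ N.subtype
  have hmem : ∀ z ∈ D, ∀ v, i v + z ∈ D := fun z hz v =>
    AffineSubspace.vadd_mem_of_mem_direction v.2 hz
  have hexp : ∀ z v, b (i v + z) (i v + z) + l (i v + z) + r =
      (b z z + l z + r) + (b z (i v) + b (i v) z + l (i v)) + b (i v) (i v) := fun z v => by
    simp only [map_add, LinearMap.add_apply]; ring
  have hbound : ∀ z ∈ D, ∃ m : ℝ, ∀ v : N,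
      m ≤ b (i v) (i v) + (b z (i v) + b (i v) z + l (i v)) := by
    rintro ⟨x, u⟩ hz
    obtain ⟨m, hm⟩ := hbdd x
    refine ⟨m - (b (x, u) (x, u) + l (x, u) + r), fun v => ?_⟩
    have e : i v + (x, u) = (x, v + u) := by ext <;> simp [i, inr]
    have h3 := hm (v + u)
    rw [← e, h1 _ (hmem _ hz v), EReal.coe_le_coe_iff, hexp] at h3
    linarith
  -- The points of `D` that are stationary along the vertical directions `N` of `D`.
  let O : AffineSubspace ℝ (E × U) :=
    { carrier := {z | z ∈ D ∧ ∀ v, b z (i v) + b (i v) z + l (i v) = 0}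
      smul_vsub_vadd_mem' := fun c p₁ p₂ p₃ hp₁ hp₂ hp₃ => by
        refine ⟨D.smul_vsub_vadd_mem c hp₁.1 hp₂.1 hp₃.1, fun v => ?_⟩
        simp only [vsub_eq_sub, vadd_eq_add, map_add, map_sub, map_smul, LinearMap.add_apply,
          LinearMap.sub_apply, LinearMap.smul_apply, smul_eq_mul]
        linear_combination c * hp₁.2 v - c * hp₂.2 v + hp₃.2 v }
  obtain ⟨L, k, hLk⟩ := O.exists_affine_section
  refine ⟨L, k, fun x u => ?_⟩
  by_cases hz : (x, u) ∈ D
  · obtain ⟨m, hm⟩ := hbound _ hz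
    obtain ⟨v, hv⟩ := exists_stationary_of_bddBelow (b.compl₁₂ i i)
      (b (x, u) ∘ₗ i + b.flip (x, u) ∘ₗ i + l ∘ₗ i) m fun v => hm v
    have hO : (x, v + u) ∈ O := by
      have e : (x, v + u) = i v + (x, u) := by ext <;> simp [i, inr]
      rw [e]
      refine ⟨hmem _ hz v, fun w => ?_⟩
      have := hv w
      simp only [LinearMap.compl₁₂_apply, LinearMap.add_apply, LinearMap.comp_apply,
        LinearMap.flip_apply] at this
      simp only [map_add, LinearMap.add_apply]
      linarith
    have hopt := hLk x _ hO
    have hd : u - (L x + k) ∈ N := by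
      have := AffineSubspace.vsub_mem_direction hz hopt.1
      change inr _ ∈ D.direction
      convert this using 1
      ext <;> simp [inr]
    have e : (x, u) = i ⟨_, hd⟩ + (x, L x + k) := by ext <;> simp [i, inr]
    -- Boundedness below makes the form nonnegative on `N`, so a stationary point is a minimum over
    -- its fibre.
    have hpos : 0 ≤ b (i ⟨_, hd⟩) (i ⟨_, hd⟩) := by
      refine (quadratic_bddBelow (m := m)
        (b := b (x, u) (i ⟨_, hd⟩) + b (i ⟨_, hd⟩) (x, u) + l (i ⟨_, hd⟩)) fun t => ?_).1
      have := hm (t • ⟨_, hd⟩)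
      simp only [map_smul, LinearMap.smul_apply, smul_eq_mul] at this
      linarith
    rw [h1 _ hz, h1 _ hopt.1, EReal.coe_le_coe_iff, e, hexp, hopt.2]
    linarith
  · rw [h2 _ hz]
    exact le_top

/-! ### Expectations of random extended quadratic functions -/

section Expectation

variable {Ω : Type*} [MeasurableSpace Ω] {μ : Measure Ω} {X : Ω → EReal}

theorem lintegral_neg_ne_top_of_expectation_ne_bot (h : ExpectationExists μ X)
    (hb : expectation μ X ≠ ⊥) : ∫⁻ ω, (-X ω).toENNReal ∂μ ≠ ∞ := by
  intro hn
  have hp := h.resolve_right (not_not.2 hn)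
  refine hb ?_
  unfold expectation
  rw [hn]
  generalize ∫⁻ ω, (X ω).toENNReal ∂μ = a
  simp

theorem lintegral_pos_ne_top_of_expectation_ne_top
    (hn : ∫⁻ ω, (-X ω).toENNReal ∂μ ≠ ∞) (ht : expectation μ X ≠ ⊤) :
    ∫⁻ ω, (X ω).toENNReal ∂μ ≠ ∞ := by
  intro hp
  refine ht ?_
  unfold expectation
  rw [hp]
  lift (∫⁻ ω, (-X ω).toENNReal ∂μ) to NNReal using hn with a
  exact EReal.top_sub_coe (a : ℝ)

theorem expectation_eq_integral {g : Ω → ℝ} (hg : Integrable g μ)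
    (h : ∀ᵐ ω ∂μ, X ω = (g ω : EReal)) : expectation μ X = ((∫ ω, g ω ∂μ : ℝ) : EReal) := by
  have hp : ∫⁻ ω, (X ω).toENNReal ∂μ = ∫⁻ ω, ENNReal.ofReal (g ω) ∂μ :=
    lintegral_congr_ae (by filter_upwards [h] with ω hω; rw [hω, EReal.real_coe_toENNReal])
  have hn : ∫⁻ ω, (-X ω).toENNReal ∂μ = ∫⁻ ω, ENNReal.ofReal (-g ω) ∂μ :=
    lintegral_congr_ae (by
      filter_upwards [h] with ω hω
      rw [hω, ← EReal.coe_neg, EReal.real_coe_toENNReal])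
  unfold expectation
  rw [hp, hn, integral_eq_lintegral_pos_part_sub_lintegral_neg_part hg, EReal.coe_sub,
    EReal.coe_ennreal_toReal hg.lintegral_lt_top.ne,
    EReal.coe_ennreal_toReal (x := ∫⁻ ω, ENNReal.ofReal (-g ω) ∂μ) hg.neg.lintegral_lt_top.ne]

theorem integrable_ereal_toReal (hX : Measurable X)
    (hp : ∫⁻ ω, (X ω).toENNReal ∂μ ≠ ∞) (hn : ∫⁻ ω, (-X ω).toENNReal ∂μ ≠ ∞) :
    Integrable (fun ω => (X ω).toReal) μ ∧ ∀ᵐ ω ∂μ, X ω = ((X ω).toReal : EReal) := by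
  have hmp : Measurable fun ω => (X ω).toENNReal := hX.ereal_toENNReal
  have hmn : Measurable fun ω => (-X ω).toENNReal := hX.neg.ereal_toENNReal
  refine ⟨⟨hX.ereal_toReal.aestronglyMeasurable, ?_⟩, ?_⟩
  · refine (lintegral_mono (g := fun ω => (X ω).toENNReal + (-X ω).toENNReal) fun ω => ?_).trans_lt
      (by rw [lintegral_add_left hmp]; exact ENNReal.add_lt_top.2 ⟨hp.lt_top, hn.lt_top⟩)
    dsimp only
    induction X ω with
    | bot => simp
    | top => simp
    | coe a =>
      rw [← EReal.coe_neg, EReal.real_coe_toENNReal, EReal.real_coe_toENNReal, EReal.toReal_coe,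
        Real.enorm_eq_ofReal_abs]
      rcases le_total 0 a with h | h
      · rw [abs_of_nonneg h]; exact le_self_add
      · rw [abs_of_nonpos h]; exact le_add_self
  · filter_upwards [ae_lt_top hmp hp, ae_lt_top hmn hn] with ω h1 h2
    refine (EReal.coe_toReal ?_ ?_).symm
    · intro h; simp [h] at h1
    · intro h; simp [h] at h2

end Expectation

/-- A random function on the line that is quadratic in the parameter has an integrable quadratic
coefficient if it is integrable at two points and has integrable negative parts everywhere. -/
theorem integrable_quadratic_coeff {Ω : Type*} [MeasurableSpace Ω] {μ : Measure Ω}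
    {y₀ y₁ γ : Ω → ℝ} (h₀ : Integrable y₀ μ) (h₁ : Integrable y₁ μ)
    (hγ : AEStronglyMeasurable γ μ)
    (h : ∀ t : ℝ, ∃ N : Ω → ℝ, Integrable N μ ∧
      ∀ᵐ ω ∂μ, N ω ≤ (1 - t) * y₀ ω + t * y₁ ω + (t ^ 2 - t) * γ ω) : Integrable γ μ := by
  -- The factor `t ^ 2 - t` is `2` at `t = 2` and `-1/4` at `t = 1/2`, so these two values bound `γ`
  -- from below and from above.
  obtain ⟨N, hN, hN'⟩ := h 2
  obtain ⟨M, hM, hM'⟩ := h (1 / 2)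
  refine Integrable.mono' (g := fun ω => |N ω| + |y₀ ω| + 2 * |y₁ ω| + 4 * |M ω| + 2 * |y₀ ω|)
    ?_ hγ ?_
  · exact (((hN.abs.add h₀.abs).add (h₁.abs.const_mul 2)).add (hM.abs.const_mul 4)).add
      (h₀.abs.const_mul 2)
  · filter_upwards [hN', hM'] with ω a b
    rw [Real.norm_eq_abs, abs_le]
    have := neg_abs_le (N ω); have := neg_abs_le (M ω)
    have := neg_abs_le (y₀ ω); have := neg_abs_le (y₁ ω)
    have := le_abs_self (y₀ ω); have := le_abs_self (y₁ ω)
    have := abs_nonneg (N ω); have := abs_nonneg (M ω)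
    constructor <;> linarith

/-- The expectation of a random extended quadratic function is extended quadratic, if it exists
and is not `-∞`. -/
theorem IsExtQuad.expectation {E : Type*} [AddCommGroup E] [Module ℝ E] {Ω : Type*}
    [MeasurableSpace Ω] {μ : Measure Ω} {f : Ω → E → EReal} (hf : ∀ ω, IsExtQuad (f ω))
    (hm : ∀ z, Measurable fun ω => f ω z) (he : ∀ z, ExpectationExists μ fun ω => f ω z)
    (hb : ∀ z, expectation μ (fun ω => f ω z) ≠ ⊥) :
    IsExtQuad fun z => expectation μ fun ω => f ω z := by
  choose D b l r h1 h2 using hf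
  let q : Ω → E → ℝ := fun ω z => b ω z z + l ω z + r ω
  let S : Set E := {z | _root_.expectation μ (fun ω => f ω z) ≠ ⊤}
  have hneg := fun z => lintegral_neg_ne_top_of_expectation_ne_bot (he z) (hb z)
  have hS : ∀ z ∈ S, Integrable (fun ω => q ω z) μ ∧ ∀ᵐ ω ∂μ, z ∈ D ω := fun z hz => by
    obtain ⟨hi, hr⟩ := integrable_ereal_toReal (hm z)
      (lintegral_pos_ne_top_of_expectation_ne_top (hneg z) hz) (hneg z)
    have hD : ∀ᵐ ω ∂μ, z ∈ D ω := by
      filter_upwards [hr] with ω hω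
      by_contra hc
      rw [h2 ω z hc] at hω
      exact EReal.coe_ne_top _ hω.symm
    refine ⟨hi.congr ?_, hD⟩
    filter_upwards [hD] with ω hω
    rw [h1 ω z hω, EReal.toReal_coe]
  have hS' : ∀ z, Integrable (fun ω => q ω z) μ → (∀ᵐ ω ∂μ, z ∈ D ω) →
      _root_.expectation μ (fun ω => f ω z) = ((∫ ω, q ω z ∂μ : ℝ) : EReal) := fun z hi hD =>
    expectation_eq_integral hi (by filter_upwards [hD] with ω hω using h1 ω z hω)
  have hqline : ∀ ω z d (t : ℝ), q ω (z + t • d) =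
      (1 - t) * q ω z + t * q ω (z + d) + (t ^ 2 - t) * b ω d d := fun ω z d t => by
    simp only [q, map_add, map_smul, LinearMap.add_apply, LinearMap.smul_apply, smul_eq_mul]
    ring
  have hline : ∀ z d, z ∈ S → z + d ∈ S → ∀ t : ℝ, z + t • d ∈ S := by
    intro z d hz hd t
    have hD : ∀ t : ℝ, ∀ᵐ ω ∂μ, z + t • d ∈ D ω := fun t => by
      filter_upwards [(hS z hz).2, (hS _ hd).2] with ω h h'
      have := (D ω).smul_vsub_vadd_mem t h' h h
      simpa [add_comm] using this
    have hmeas : ∀ t : ℝ, AEStronglyMeasurable (fun ω => q ω (z + t • d)) μ := fun t => by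
      refine (hm (z + t • d)).ereal_toReal.aestronglyMeasurable.congr ?_
      filter_upwards [hD t] with ω hω
      rw [h1 ω _ hω, EReal.toReal_coe]
    -- The chosen coefficients `b`, `l`, `r` need not be measurable in `ω`; this one is recovered as
    -- a second difference of measurable values.
    have hγm : AEStronglyMeasurable (fun ω => b ω d d) μ := by
      have e : (fun ω => b ω d d) = fun ω =>
          (1 / 2 : ℝ) * q ω (z + (2 : ℝ) • d) + (1 / 2 * q ω z - q ω (z + d)) := by
        funext ω; rw [hqline]; ring
      rw [e]
      exact ((hmeas 2).const_mul _).add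
        (((hS z hz).1.aestronglyMeasurable.const_mul _).sub (hS _ hd).1.aestronglyMeasurable)
    have hγ : Integrable (fun ω => b ω d d) μ := by
      refine integrable_quadratic_coeff (hS z hz).1 (hS _ hd).1 hγm fun t => ?_
      refine ⟨fun ω => -((-f ω (z + t • d)).toENNReal).toReal,
        (integrable_toReal_of_lintegral_ne_top
          (hm (z + t • d)).neg.ereal_toENNReal.aemeasurable (hneg _)).neg, ?_⟩
      filter_upwards [hD t] with ω hω
      rw [← hqline, h1 ω _ hω, ← EReal.coe_neg, EReal.real_coe_toENNReal,
        ENNReal.toReal_ofReal', neg_le]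
      exact le_max_left _ _
    refine (hS' _ ?_ (hD t)).trans_ne (EReal.coe_ne_top _)
    simp only [hqline]
    exact (((hS z hz).1.const_mul _).add ((hS _ hd).1.const_mul _)).add (hγ.const_mul _)
  -- A set closed under lines is affine: `p₃ + c (p₁ - p₂)` is the midpoint of `p₂ + 2 c (p₁ - p₂)`
  -- and `p₂ + 2 (p₃ - p₂)`.
  let A : AffineSubspace ℝ E :=
    { carrier := S
      smul_vsub_vadd_mem' := fun c p₁ p₂ p₃ hp₁ hp₂ hp₃ => by
        have ha := hline p₂ (p₁ - p₂) hp₂ (by simpa using hp₁) (2 * c)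
        have hb := hline p₂ (p₃ - p₂) hp₂ (by simpa using hp₃) 2
        have hc := hline _ (p₂ + (2 : ℝ) • (p₃ - p₂) - (p₂ + (2 * c) • (p₁ - p₂))) ha
          (by simpa using hb) (1 / 2)
        convert hc using 1
        simp only [vsub_eq_sub, vadd_eq_add]
        module }
  rcases (A : Set E).eq_empty_or_nonempty with hA | ⟨z₀, hz₀⟩
  · refine ⟨A, 0, 0, 0, fun z hz => ((Set.eq_empty_iff_forall_notMem.1 hA z) hz).elim,
      fun z hz => not_not.1 hz⟩
  have hV : ∀ v : A.direction, Integrable (fun ω => q ω (z₀ + v)) μ := fun v => by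
    have := AffineSubspace.vadd_mem_of_mem_direction v.2 hz₀
    rw [vadd_eq_add, add_comm] at this
    exact (hS _ this).1
  have hq₀ : Integrable (fun ω => q ω z₀) μ := (hS _ hz₀).1
  -- Polarization: the symmetrized form is a combination of four integrable values of `q`. This
  -- works only along the direction of `A`, hence the form below lives there.
  have hβ : ∀ v w : A.direction, Integrable (fun ω => b ω v w + b ω w v) μ := fun v w => by
    have e : (fun ω => b ω v w + b ω w v) = fun ω =>
        (q ω (z₀ + (v + w : A.direction)) + q ω z₀) - (q ω (z₀ + v) + q ω (z₀ + w)) := by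
      funext ω
      simp only [q, map_add, LinearMap.add_apply, Submodule.coe_add]
      ring
    rw [e]
    exact ((hV _).add hq₀).sub ((hV v).add (hV w))
  have hl : ∀ v : A.direction, Integrable (fun ω => b ω z₀ v + b ω v z₀ + l ω v) μ := fun v => by
    have e : (fun ω => b ω z₀ v + b ω v z₀ + l ω v) = fun ω =>
        (q ω (z₀ + v) - q ω z₀) - (1 / 2 : ℝ) * (b ω v v + b ω v v) := by
      funext ω
      simp only [q, map_add, LinearMap.add_apply]
      ring
    rw [e]
    exact ((hV v).sub hq₀).sub ((hβ v v).const_mul _)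
  let B : A.direction →ₗ[ℝ] A.direction →ₗ[ℝ] ℝ :=
    LinearMap.mk₂ ℝ (fun v w => ∫ ω, (b ω v w + b ω w v) ∂μ)
      (fun v v' w => by
        rw [← integral_add (hβ _ _) (hβ _ _)]
        congr 1 with ω
        simp only [map_add, LinearMap.add_apply, Submodule.coe_add]; ring)
      (fun c v w => by
        rw [smul_eq_mul, ← integral_const_mul]
        congr 1 with ω
        simp only [map_smul, LinearMap.smul_apply, Submodule.coe_smul, smul_eq_mul]; ring)
      (fun v w w' => by
        rw [← integral_add (hβ _ _) (hβ _ _)]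
        congr 1 with ω
        simp only [map_add, LinearMap.add_apply, Submodule.coe_add]; ring)
      (fun c v w => by
        rw [smul_eq_mul, ← integral_const_mul]
        congr 1 with ω
        simp only [map_smul, LinearMap.smul_apply, Submodule.coe_smul, smul_eq_mul]; ring)
  let Λ : A.direction →ₗ[ℝ] ℝ :=
    { toFun := fun v => ∫ ω, (b ω z₀ v + b ω v z₀ + l ω v) ∂μ
      map_add' := fun v w => by
        rw [← integral_add (hl _) (hl _)]
        congr 1 with ω
        simp only [map_add, LinearMap.add_apply, Submodule.coe_add]; ring
      map_smul' := fun c v => by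
        rw [RingHom.id_apply, smul_eq_mul, ← integral_const_mul]
        congr 1 with ω
        simp only [map_smul, LinearMap.smul_apply, Submodule.coe_smul, smul_eq_mul]; ring }
  -- A linear projection onto the direction extends the integrated coefficients to `E`; their values
  -- off the direction are irrelevant.
  obtain ⟨P, hP⟩ := A.direction.subtype.exists_leftInverse_of_injective A.direction.ker_subtype
  have hPv : ∀ v : A.direction, P v = v := fun v => LinearMap.congr_fun hP v
  have key : IsExtQuad fun v => _root_.expectation μ fun ω => f ω (v + z₀) := by
    refine ⟨A.direction.toAffineSubspace, (1 / 2 : ℝ) • B.compl₁₂ P P, Λ ∘ₗ P, ∫ ω, q ω z₀ ∂μ,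
      fun v hv => ?_, fun v hv => ?_⟩
    · have hv : v ∈ A.direction := hv
      have hvS : v + z₀ ∈ S := AffineSubspace.vadd_mem_of_mem_direction hv hz₀
      refine (hS' _ (hS _ hvS).1 (hS _ hvS).2).trans ?_
      congr 1
      have hPv' : P v = ⟨v, hv⟩ := hPv ⟨v, hv⟩
      simp only [LinearMap.smul_apply, LinearMap.compl₁₂_apply, LinearMap.comp_apply, hPv', B, Λ,
        LinearMap.mk₂_apply, LinearMap.coe_mk, AddHom.coe_mk, smul_eq_mul]
      rw [← integral_const_mul, ← integral_add ((hβ ⟨v, hv⟩ ⟨v, hv⟩).const_mul _) (hl ⟨v, hv⟩),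
        ← integral_add
          (show Integrable (fun ω => 1 / 2 * (b ω v v + b ω v v) + (b ω z₀ v + b ω v z₀ + l ω v)) μ
            from ((hβ ⟨v, hv⟩ ⟨v, hv⟩).const_mul _).add (hl ⟨v, hv⟩)) hq₀]
      congr 1 with ω
      simp only [q, map_add, LinearMap.add_apply]
      ring
    · by_contra hc
      exact hv (show v ∈ A.direction by
        simpa using AffineSubspace.vsub_mem_direction (show v + z₀ ∈ A from hc) hz₀)
  simpa using key.comp_affine LinearMap.id (-z₀)

/-! ### Product measures and measurability -/

/-- Resampling one coordinate preserves a product measure. -/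
theorem measurePreserving_update_infinitePi {ι : Type*} [DecidableEq ι] {X : ι → Type*}
    [∀ i, MeasurableSpace (X i)] (μ : ∀ i, Measure (X i)) [∀ i, IsProbabilityMeasure (μ i)]
    (i : ι) : MeasurePreserving (fun p : X i × (∀ j, X j) => Function.update p.2 i p.1)
      ((μ i).prod (Measure.infinitePi μ)) (Measure.infinitePi μ) := by
  have hm : Measurable fun p : X i × (∀ j, X j) => Function.update p.2 i p.1 :=
    measurable_update'.comp measurable_swap
  refine ⟨hm, Measure.eq_infinitePi μ fun s t ht => ?_⟩
  have hms : ∀ s : Finset ι, MeasurableSet (Set.pi (s : Set ι) t) := fun s =>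
    MeasurableSet.pi s.countable_toSet fun j _ => ht j
  rw [Measure.map_apply hm (hms s)]
  by_cases hi : i ∈ s
  · have e : (fun p : X i × (∀ j, X j) => Function.update p.2 i p.1) ⁻¹' Set.pi (s : Set ι) t =
        t i ×ˢ Set.pi ((s.erase i : Finset ι) : Set ι) t := by
      ext p
      simp only [Set.mem_preimage, Set.mem_pi, Set.mem_prod, Finset.mem_coe, Finset.mem_erase]
      constructor
      · intro h
        refine ⟨by simpa using h i hi, fun j hj => by simpa [hj.1] using h j hj.2⟩
      · rintro ⟨h1, h2⟩ j hj
        rcases eq_or_ne j i with rfl | hji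
        · simpa using h1
        · simpa [hji] using h2 j ⟨hji, hj⟩
    rw [e, Measure.prod_prod, Measure.infinitePi_pi μ (fun j _ => ht j), Finset.mul_prod_erase s
      (fun j => μ j (t j)) hi]
  · have e : (fun p : X i × (∀ j, X j) => Function.update p.2 i p.1) ⁻¹' Set.pi (s : Set ι) t =
        Set.univ ×ˢ Set.pi (s : Set ι) t := by
      ext p
      simp only [Set.mem_preimage, Set.mem_pi, Set.mem_prod, Finset.mem_coe, Set.mem_univ, true_and]
      refine forall₂_congr fun j hj => ?_
      rw [Function.update_of_ne (ne_of_mem_of_not_mem hj hi)]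
    rw [e, Measure.prod_prod, measure_univ, one_mul, Measure.infinitePi_pi μ (fun j _ => ht j)]

theorem measurable_extQuad {ι α : Type*} [Fintype ι] [MeasurableSpace α] {p : ℕ}
    {M : α → Matrix (ι ⊕ Unit) (ι ⊕ Unit) ℝ} {F : Matrix (Fin p) ι ℝ} {g : Fin p → ℝ}
    {z : α → ι → ℝ} (hM : ∀ i j, Measurable fun a => M a i j) (hz : Measurable z) :
    Measurable fun a => extQuad (M a) F g (z a) := by
  have hz' : ∀ i, Measurable fun a => z a i := fun i => (measurable_pi_apply i).comp hz
  have ha : ∀ i, Measurable fun a => appendOne (z a) i := by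
    rintro (i | i)
    · exact hz' i
    · exact measurable_const
  unfold extQuad
  refine Measurable.ite ?_ (measurable_coe_real_ereal.comp ?_) measurable_const
  · have : Measurable fun a => F *ᵥ z a + g := measurable_pi_lambda _ fun i => by
      simp only [Pi.add_apply, mulVec, dotProduct]
      exact (Finset.measurable_sum _ fun j _ => (hz' j).const_mul _).add_const _
    exact this (measurableSet_singleton 0)
  · simp only [mulVec, dotProduct]
    exact (Finset.measurable_sum _ fun i _ => (ha i).mul
      (Finset.measurable_sum _ fun j _ => (hM i j).mul (ha j))).const_mul _

/-! ### Recursive structure of the total cost -/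

namespace ExtQuadControl

variable {n m K : ℕ} {W : ℕ → Type*} [∀ t, MeasurableSpace (W t)] (C : ExtQuadControl n m K W)

theorem traj_succ (φ : PolicySeq n m K) (t : ℕ) (s : Fin K) (x : Fin n → ℝ)
    (ω : (t : ℕ) → W t × (Fin K → Fin K)) (k : ℕ) :
    C.traj φ t s x ω (k + 1) =
      C.traj φ (t + 1) ((ω t).2 s) (C.dyn t s x (φ t s x) (ω t).1) ω k := by
  induction k with
  | zero => rfl
  | succ k ih =>
    rw [traj, ih, traj]
    exact congrArg (fun τ => (C.dyn τ _ _ (φ τ _ _) (ω τ).1, (ω τ).2 _))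
      (show t + (k + 1) = t + 1 + k by omega)

theorem totalCost_horizon (φ : PolicySeq n m K) (s : Fin K) (x : Fin n → ℝ)
    (ω : (t : ℕ) → W t × (Fin K → Fin K)) :
    C.totalCost φ C.horizon s x ω = C.finalCost s x := by
  unfold totalCost
  rw [Nat.sub_self, Finset.sum_range_zero, zero_add]
  rfl

theorem totalCost_of_lt (φ : PolicySeq n m K) {t : ℕ} (ht : t < C.horizon) (s : Fin K)
    (x : Fin n → ℝ) (ω : (t : ℕ) → W t × (Fin K → Fin K)) :
    C.totalCost φ t s x ω = C.stageCost t s x (φ t s x) (ω t).1 +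
      C.totalCost φ (t + 1) ((ω t).2 s) (C.dyn t s x (φ t s x) (ω t).1) ω := by
  unfold totalCost
  rw [show C.horizon - t = (C.horizon - (t + 1)) + 1 by omega, Finset.sum_range_succ',
    C.traj_succ φ t s x ω, add_comm (Finset.sum _ _), add_assoc]
  congr 2
  refine Finset.sum_congr rfl fun k _ => ?_
  rw [C.traj_succ φ t s x ω]
  exact congrArg (fun τ => C.stageCost τ _ _ (φ τ _ _) (ω τ).1)
    (show t + (k + 1) = t + 1 + k by omega)

theorem stageCost_ne_bot (t : ℕ) (s : Fin K) (x : Fin n → ℝ) (u : Fin m → ℝ) (w : W t) :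
    C.stageCost t s x u w ≠ ⊥ :=
  (IsExtQuad.extQuad _ _ _).ne_bot _

theorem finalCost_ne_bot (s : Fin K) (x : Fin n → ℝ) : C.finalCost s x ≠ ⊥ :=
  (IsExtQuad.extQuad _ _ _).ne_bot _

/-- Backward induction from the horizon. -/
theorem backward_induction {T : ℕ} {motive : ℕ → Prop} (base : motive T)
    (step : ∀ t < T, motive (t + 1) → motive t) {t : ℕ} (ht : t ≤ T) : motive t := by
  induction ht using Nat.decreasingInduction with
  | self => exact base
  | of_succ k hk ih => exact step k hk ih

theorem totalCost_ne_bot (φ : PolicySeq n m K) {t : ℕ} (ht : t ≤ C.horizon) :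
    ∀ s x ω, C.totalCost φ t s x ω ≠ ⊥ := by
  refine backward_induction (motive := fun t => ∀ s x ω, C.totalCost φ t s x ω ≠ ⊥)
    (fun s x ω => ?_) (fun t ht ih s x ω => ?_) ht
  · rw [totalCost_horizon]; exact C.finalCost_ne_bot s x
  · rw [C.totalCost_of_lt φ ht]
    exact EReal.add_ne_bot_iff.2 ⟨C.stageCost_ne_bot _ _ _ _ _, ih _ _ _⟩

theorem totalCost_congr {φ ψ : PolicySeq n m K} {t : ℕ} (ht : t ≤ C.horizon)
    (h : ∀ τ, t ≤ τ → φ τ = ψ τ) : ∀ s x ω, C.totalCost φ t s x ω = C.totalCost ψ t s x ω := by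
  revert h
  refine backward_induction (motive := fun t => (∀ τ, t ≤ τ → φ τ = ψ τ) →
    ∀ s x ω, C.totalCost φ t s x ω = C.totalCost ψ t s x ω)
    (fun h s x ω => ?_) (fun t ht ih h s x ω => ?_) ht
  · rw [totalCost_horizon, totalCost_horizon]
  · rw [C.totalCost_of_lt φ ht, C.totalCost_of_lt ψ ht, h t le_rfl,
      ih (fun τ hτ => h τ (by omega))]

/-- The future cost ignores past randomness; this is how independence across time enters. -/
theorem totalCost_update (φ : PolicySeq n m K) {t t₀ : ℕ} (ht : t ≤ C.horizon) (h : t₀ < t)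
    (a : W t₀ × (Fin K → Fin K)) : ∀ s x ω,
      C.totalCost φ t s x (Function.update ω t₀ a) = C.totalCost φ t s x ω := by
  revert h
  refine backward_induction (motive := fun t => t₀ < t → ∀ s x ω,
      C.totalCost φ t s x (Function.update ω t₀ a) = C.totalCost φ t s x ω)
    (fun h s x ω => ?_) (fun t ht ih h s x ω => ?_) ht
  · rw [totalCost_horizon, totalCost_horizon]
  · rw [C.totalCost_of_lt φ ht, C.totalCost_of_lt φ ht, Function.update_of_ne h.ne',
      ih (by omega)]

theorem measurable_dyn {α : Type*} [MeasurableSpace α] (t : ℕ) (s : Fin K) {x : α → Fin n → ℝ}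
    {u : α → Fin m → ℝ} {w : α → W t} (hx : Measurable x) (hu : Measurable u)
    (hw : Measurable w) : Measurable fun a => C.dyn t s (x a) (u a) (w a) := by
  refine measurable_pi_lambda _ fun i => ?_
  simp only [dyn, Pi.add_apply, mulVec, dotProduct]
  refine ((Finset.measurable_sum _ fun j _ => ?_).add (Finset.measurable_sum _ fun j _ => ?_)).add
    ((C.measurable_c t s i).comp hw)
  · exact ((C.measurable_A t s i j).comp hw).mul ((measurable_pi_apply j).comp hx)
  · exact ((C.measurable_B t s i j).comp hw).mul ((measurable_pi_apply j).comp hu)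

theorem measurable_stageCost {α : Type*} [MeasurableSpace α] (t : ℕ) (s : Fin K)
    {x : α → Fin n → ℝ} {u : α → Fin m → ℝ} {w : α → W t} (hx : Measurable x)
    (hu : Measurable u) (hw : Measurable w) :
    Measurable fun a => C.stageCost t s (x a) (u a) (w a) := by
  refine measurable_extQuad (fun i j => (C.measurable_G t s i j).comp hw) ?_
  refine measurable_pi_lambda _ ?_
  rintro (i | i)
  · exact (measurable_pi_apply i).comp hx
  · exact (measurable_pi_apply i).comp hu

/-- Joint measurability in state and outcome is needed for the induction, which substitutes the
random next state. The random mode is harmless as it takes finitely many values. -/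
theorem measurable_totalCost {φ : PolicySeq n m K} (hφ : ∀ τ σ, Measurable (φ τ σ)) {t : ℕ}
    (ht : t ≤ C.horizon) : ∀ s, Measurable
      fun p : (Fin n → ℝ) × ((t : ℕ) → W t × (Fin K → Fin K)) => C.totalCost φ t s p.1 p.2 := by
  refine backward_induction (motive := fun t => ∀ s, Measurable
      fun p : (Fin n → ℝ) × ((t : ℕ) → W t × (Fin K → Fin K)) => C.totalCost φ t s p.1 p.2)
    (fun s => ?_) (fun t ht ih s => ?_) ht
  · simp only [totalCost_horizon]
    exact measurable_extQuad (fun i j => measurable_const) measurable_fst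
  · simp only [C.totalCost_of_lt φ ht]
    have hω : Measurable fun p : (Fin n → ℝ) × ((t : ℕ) → W t × (Fin K → Fin K)) => p.2 t :=
      (measurable_pi_apply t).comp measurable_snd
    have hu : Measurable fun p : (Fin n → ℝ) × ((t : ℕ) → W t × (Fin K → Fin K)) => φ t s p.1 :=
      (hφ t s).comp measurable_fst
    have htail : Measurable fun q : Fin K × ((Fin n → ℝ) × ((t : ℕ) → W t × (Fin K → Fin K))) =>
        C.totalCost φ (t + 1) q.1 q.2.1 q.2.2 := measurable_from_prod_countable_right ih
    have hmode : Measurable fun p : (Fin n → ℝ) × ((t : ℕ) → W t × (Fin K → Fin K)) =>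
        (p.2 t).2 s := (measurable_pi_apply s).comp hω.snd
    have hdyn : Measurable fun p : (Fin n → ℝ) × ((t : ℕ) → W t × (Fin K → Fin K)) =>
        C.dyn t s p.1 (φ t s p.1) (p.2 t).1 := C.measurable_dyn t s measurable_fst hu hω.fst
    have h1 := C.measurable_stageCost t s measurable_fst hu hω.fst
    have h2 := htail.comp (hmode.prodMk (hdyn.prodMk measurable_snd))
    exact Measurable.add h1 h2

theorem isExtQuad_stageCost (t : ℕ) (s : Fin K) (w : W t) :
    IsExtQuad fun z : (Fin n → ℝ) × (Fin m → ℝ) => C.stageCost t s z.1 z.2 w := by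
  let J : (Fin n → ℝ) × (Fin m → ℝ) →ₗ[ℝ] (Fin n ⊕ Fin m → ℝ) :=
    { toFun := fun z => Sum.elim z.1 z.2
      map_add' := fun x y => by ext (i | i) <;> simp
      map_smul' := fun c x => by ext (i | i) <;> simp }
  have h := (IsExtQuad.extQuad (C.G t s w) (fromCols (C.F t s) (C.H t s)) (C.h t s)).comp_affine
    J 0
  simp only [add_zero] at h
  exact h

theorem isExtQuad_stageCost_add {v : (Fin n → ℝ) → EReal} (hv : IsExtQuad v) (t : ℕ)
    (s : Fin K) (w : W t) : IsExtQuad fun z : (Fin n → ℝ) × (Fin m → ℝ) =>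
      C.stageCost t s z.1 z.2 w + v (C.dyn t s z.1 z.2 w) :=
  (C.isExtQuad_stageCost t s w).add
    (hv.comp_affine ((C.A t s w).mulVecLin ∘ₗ LinearMap.fst ℝ _ _ +
      (C.B t s w).mulVecLin ∘ₗ LinearMap.snd ℝ _ _) (C.c t s w))

/-- Under affine policies the total cost is an extended quadratic function of the state. -/
theorem isExtQuad_totalCost (gain : ℕ → Fin K → Matrix (Fin m) (Fin n) ℝ)
    (offset : ℕ → Fin K → Fin m → ℝ) (ω : (t : ℕ) → W t × (Fin K → Fin K)) {t : ℕ}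
    (ht : t ≤ C.horizon) : ∀ s, IsExtQuad fun x =>
      C.totalCost (affinePolicy gain offset) t s x ω := by
  refine backward_induction (motive := fun t => ∀ s, IsExtQuad fun x =>
      C.totalCost (affinePolicy gain offset) t s x ω) (fun s => ?_) (fun t ht ih s => ?_) ht
  · simp only [totalCost_horizon]
    exact IsExtQuad.extQuad _ _ _
  · simp only [C.totalCost_of_lt _ ht]
    have h := (C.isExtQuad_stageCost_add (ih ((ω t).2 s)) t s (ω t).1).comp_affine
      (LinearMap.prod LinearMap.id (gain t s).mulVecLin) (0, offset t s)
    have e : ∀ x, LinearMap.prod LinearMap.id (gain t s).mulVecLin x + (0, offset t s) =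
        (x, affinePolicy gain offset t s x) := fun x => by ext <;> simp [affinePolicy]
    simp only [e] at h
    exact h

end ExtQuadControl

/-! ### Comparing expectations without subtraction -/

/-- With negative parts moved across, an inequality of expectations becomes one of sums in `ℝ≥0∞`,
which can be integrated over the randomness of one time step. -/
theorem EReal.coe_ennreal_sub_le_sub {p₁ n₁ p₂ n₂ : ℝ≥0∞} (hp₁ : p₁ ≠ ∞) (hn₁ : n₁ ≠ ∞)
    (hn₂ : n₂ ≠ ∞) (h : p₂ + n₁ ≤ p₁ + n₂) : (p₂ : EReal) - n₂ ≤ (p₁ : EReal) - n₁ := by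
  have hp₂ : p₂ ≠ ∞ := ne_top_of_le_ne_top (ENNReal.add_ne_top.2 ⟨hp₁, hn₂⟩)
    (le_self_add.trans h)
  lift p₁ to NNReal using hp₁
  lift p₂ to NNReal using hp₂
  lift n₁ to NNReal using hn₁
  lift n₂ to NNReal using hn₂
  have h' : (p₂ : ℝ) + n₁ ≤ p₁ + n₂ := by exact_mod_cast h
  simp only [EReal.coe_nnreal_eq_coe_real, ← EReal.coe_sub, EReal.coe_le_coe_iff]
  linarith

theorem ENNReal.add_le_add_of_ereal_sub_le_sub {p₁ n₁ p₂ n₂ : ℝ≥0∞} (hp₁ : p₁ ≠ ∞)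
    (hn₁ : n₁ ≠ ∞) (hp₂ : p₂ ≠ ∞) (hn₂ : n₂ ≠ ∞)
    (h : (p₂ : EReal) - n₂ ≤ (p₁ : EReal) - n₁) : p₂ + n₁ ≤ p₁ + n₂ := by
  lift p₁ to NNReal using hp₁
  lift p₂ to NNReal using hp₂
  lift n₁ to NNReal using hn₁
  lift n₂ to NNReal using hn₂
  simp only [EReal.coe_nnreal_eq_coe_real, ← EReal.coe_sub, EReal.coe_le_coe_iff] at h
  have : (p₂ : ℝ) + n₁ ≤ p₁ + n₂ := by linarith
  exact_mod_cast this

section Expectation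

variable {Ω : Type*} [MeasurableSpace Ω] {μ : Measure Ω}

theorem lintegral_ne_top_of_ae_eq_coe {X : Ω → EReal} {g : Ω → ℝ} (hg : Integrable g μ)
    (h : ∀ᵐ ω ∂μ, X ω = (g ω : EReal)) :
    ∫⁻ ω, (X ω).toENNReal ∂μ ≠ ∞ ∧ ∫⁻ ω, (-X ω).toENNReal ∂μ ≠ ∞ := by
  constructor
  · refine ((lintegral_congr_ae ?_).trans_lt hg.lintegral_lt_top).ne
    filter_upwards [h] with ω hω
    rw [hω, EReal.real_coe_toENNReal]
  · refine ((lintegral_congr_ae ?_).trans_lt hg.neg.lintegral_lt_top).ne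
    filter_upwards [h] with ω hω
    rw [hω, ← EReal.coe_neg, EReal.real_coe_toENNReal, Pi.neg_apply]

/-- Adding a constant to two random variables does not change the order of their expectations. -/
theorem lintegral_add_le_of_expectation_le [IsProbabilityMeasure μ] {T₁ T₂ : Ω → EReal}
    (hT₁ : Measurable T₁) (hT₂ : Measurable T₂) (hb₁ : ∀ ω, T₁ ω ≠ ⊥) (hb₂ : ∀ ω, T₂ ω ≠ ⊥)
    {c : EReal} (hc : c ≠ ⊥) (hp : ∫⁻ ω, (c + T₁ ω).toENNReal ∂μ ≠ ∞)
    (hn : ∫⁻ ω, (-(c + T₁ ω)).toENNReal ∂μ ≠ ∞)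
    (h₂ : ExpectationExists μ T₂) (h₂b : expectation μ T₂ ≠ ⊥)
    (h : ExpectationExists μ T₁ → expectation μ T₂ ≤ expectation μ T₁) :
    ∫⁻ ω, (c + T₂ ω).toENNReal ∂μ + ∫⁻ ω, (-(c + T₁ ω)).toENNReal ∂μ ≤
      ∫⁻ ω, (c + T₁ ω).toENNReal ∂μ + ∫⁻ ω, (-(c + T₂ ω)).toENNReal ∂μ := by
  induction c with
  | bot => exact (hc rfl).elim
  | top => simp only [EReal.top_add_of_ne_bot (hb₁ _), EReal.top_add_of_ne_bot (hb₂ _), le_refl]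
  | coe c =>
    obtain ⟨hi₁, he₁⟩ := integrable_ereal_toReal (X := fun ω => (c : EReal) + T₁ ω)
      (measurable_const.add hT₁) hp hn
    have hic : Integrable (fun _ : Ω => c) μ := integrable_const c
    have hT₁' : ∀ᵐ ω ∂μ, T₁ ω = (((c + T₁ ω : EReal).toReal - c : ℝ) : EReal) := by
      filter_upwards [he₁] with ω hω
      have hb := hb₁ ω
      generalize T₁ ω = y at hω hb ⊢
      induction y with
      | bot => exact (hb rfl).elim
      | top => exact (EReal.coe_ne_top _ (hω.symm.trans (EReal.coe_add_top c))).elim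
      | coe y => rw [← EReal.coe_add, EReal.toReal_coe, add_sub_cancel_left]
    have hj₁ := hi₁.sub hic
    -- `T₁` is integrable, being `c + T₁` minus a finite constant, so the conditional hypothesis
    -- applies.
    have hle := h (Or.inl (lintegral_ne_top_of_ae_eq_coe hj₁ hT₁').1)
    rw [expectation_eq_integral hj₁ hT₁'] at hle
    have hn₂ := lintegral_neg_ne_top_of_expectation_ne_bot h₂ h₂b
    have hp₂ := lintegral_pos_ne_top_of_expectation_ne_top hn₂
      (ne_top_of_le_ne_top (EReal.coe_ne_top _) hle)
    obtain ⟨hi₂, he₂⟩ := integrable_ereal_toReal hT₂ hp₂ hn₂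
    have hT₂' : ∀ᵐ ω ∂μ, (c : EReal) + T₂ ω = ((c + (T₂ ω).toReal : ℝ) : EReal) := by
      filter_upwards [he₂] with ω hω
      rw [EReal.coe_add, ← hω]
    have hj₂ := hic.add hi₂
    obtain ⟨hp₃, hn₃⟩ := lintegral_ne_top_of_ae_eq_coe hj₂ hT₂'
    refine ENNReal.add_le_add_of_ereal_sub_le_sub hp hn hp₃ hn₃ ?_
    refine (expectation_eq_integral hj₂ hT₂').trans_le
      (le_trans ?_ (expectation_eq_integral hi₁ he₁).ge)
    rw [expectation_eq_integral hi₂ he₂] at hle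
    rw [EReal.coe_le_coe_iff] at hle ⊢
    rw [integral_sub' hi₁ hic] at hle
    rw [integral_add' hic hi₂]
    linarith

end Expectation

/-! ### The dynamic programming step -/

namespace ExtQuadControl

variable {n m K : ℕ} {W : ℕ → Type*} [∀ t, MeasurableSpace (W t)] (C : ExtQuadControl n m K W)

theorem lintegral_law_eq (t : ℕ) {f : ((t : ℕ) → W t × (Fin K → Fin K)) → ℝ≥0∞}
    (hf : Measurable f) : ∫⁻ ω, f ω ∂C.law = ∫⁻ a, ∫⁻ ω, f (Function.update ω t a) ∂C.law
      ∂((C.dist t).prod (Measure.pi fun j => (C.nextMode t j).toMeasure)) := by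
  have := C.isProb
  have hmp := measurePreserving_update_infinitePi
    (fun t => (C.dist t).prod (Measure.pi fun j => (C.nextMode t j).toMeasure)) t
  have h := hmp.lintegral_comp hf
  exact h.symm.trans (lintegral_prod _ (hf.comp hmp.measurable).aemeasurable)

/-- Finite integrals are finite on almost every fibre, so the comparison is required only where the
conditional parts `p₁`, `n₁` are finite. -/
theorem lintegral_law_add_le (t : ℕ) {p₁ n₁ p₂ n₂ : ((t : ℕ) → W t × (Fin K → Fin K)) → ℝ≥0∞}
    (hp₁ : Measurable p₁) (hn₁ : Measurable n₁) (hp₂ : Measurable p₂) (hn₂ : Measurable n₂)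
    (hp : ∫⁻ ω, p₁ ω ∂C.law ≠ ∞) (hn : ∫⁻ ω, n₁ ω ∂C.law ≠ ∞)
    (h : ∀ a, ∫⁻ ω, p₁ (Function.update ω t a) ∂C.law ≠ ∞ →
      ∫⁻ ω, n₁ (Function.update ω t a) ∂C.law ≠ ∞ →
      ∫⁻ ω, p₂ (Function.update ω t a) ∂C.law + ∫⁻ ω, n₁ (Function.update ω t a) ∂C.law ≤
        ∫⁻ ω, p₁ (Function.update ω t a) ∂C.law + ∫⁻ ω, n₂ (Function.update ω t a) ∂C.law) :
    ∫⁻ ω, p₂ ω ∂C.law + ∫⁻ ω, n₁ ω ∂C.law ≤ ∫⁻ ω, p₁ ω ∂C.law + ∫⁻ ω, n₂ ω ∂C.law := by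
  have hupd : Measurable fun p : (W t × (Fin K → Fin K)) × ((t : ℕ) → W t × (Fin K → Fin K)) =>
      Function.update p.2 t p.1 := measurable_update'.comp measurable_swap
  have hin : ∀ {f : ((t : ℕ) → W t × (Fin K → Fin K)) → ℝ≥0∞}, Measurable f →
      Measurable fun a => ∫⁻ ω, f (Function.update ω t a) ∂C.law := fun {f} hf =>
    Measurable.lintegral_prod_right' (f := fun p : (W t × (Fin K → Fin K)) ×
      ((t : ℕ) → W t × (Fin K → Fin K)) => f (Function.update p.2 t p.1)) (hf.comp hupd)
  rw [C.lintegral_law_eq t hp₁] at hp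
  rw [C.lintegral_law_eq t hn₁] at hn
  rw [C.lintegral_law_eq t hp₁, C.lintegral_law_eq t hp₂, C.lintegral_law_eq t hn₁,
    C.lintegral_law_eq t hn₂, ← lintegral_add_left (hin hp₁), ← lintegral_add_left (hin hp₂)]
  refine lintegral_mono_ae ?_
  filter_upwards [ae_lt_top (hin hp₁) hp, ae_lt_top (hin hn₁) hn] with a h₁ h₂
  exact h a h₁.ne h₂.ne

theorem measurable_affinePolicy (gain : ℕ → Fin K → Matrix (Fin m) (Fin n) ℝ)
    (offset : ℕ → Fin K → Fin m → ℝ) (τ : ℕ) (σ : Fin K) :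
    Measurable (affinePolicy gain offset τ σ) := by
  refine measurable_pi_lambda _ fun i => ?_
  simp only [affinePolicy, Pi.add_apply, mulVec, dotProduct]
  exact (Finset.measurable_sum _ fun j _ => (measurable_pi_apply j).const_mul _).add_const _

theorem measurable_totalCost_right {φ : PolicySeq n m K} (hφ : ∀ τ σ, Measurable (φ τ σ))
    {t : ℕ} (ht : t ≤ C.horizon) (s : Fin K) (x : Fin n → ℝ) :
    Measurable (C.totalCost φ t s x) := by
  have h : Measurable fun ω : (t : ℕ) → W t × (Fin K → Fin K) => (x, ω) :=
    measurable_const.prodMk measurable_id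
  have h' := (C.measurable_totalCost hφ ht s).comp h
  simp only [Function.comp_def] at h'
  exact h'

/-- Switching from the policies `φ` to policies `ψ` after time `t` does not increase the expected
cost from time `t`, if `ψ` is at least as good from time `t + 1`. -/
theorem expectedCost_le_of_tail {φ ψ : PolicySeq n m K} (hφ : ∀ τ σ, Measurable (φ τ σ))
    (hψ : ∀ τ σ, Measurable (ψ τ σ)) {t : ℕ} (ht : t < C.horizon) {s : Fin K} {x : Fin n → ℝ}
    (hu : ψ t s x = φ t s x) (hφe : C.IsAdmissible t s x φ) (hφb : C.expectedCost φ t s x ≠ ⊥)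
    (hψe : C.IsAdmissible t s x ψ) (hψb : C.expectedCost ψ t s x ≠ ⊥)
    (htail : ∀ s' x', C.IsAdmissible (t + 1) s' x' ψ ∧ C.expectedCost ψ (t + 1) s' x' ≠ ⊥ ∧
      (C.IsAdmissible (t + 1) s' x' φ →
        C.expectedCost ψ (t + 1) s' x' ≤ C.expectedCost φ (t + 1) s' x')) :
    C.expectedCost ψ t s x ≤ C.expectedCost φ t s x := by
  rcases eq_or_ne (C.expectedCost φ t s x) ⊤ with htop | htop
  · rw [htop]; exact le_top
  have hn₁ := lintegral_neg_ne_top_of_expectation_ne_bot hφe.2 hφb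
  have hp₁ := lintegral_pos_ne_top_of_expectation_ne_top hn₁ htop
  have hn₂ := lintegral_neg_ne_top_of_expectation_ne_bot hψe.2 hψb
  refine EReal.coe_ennreal_sub_le_sub hp₁ hn₁ hn₂ ?_
  have hm₁ := C.measurable_totalCost_right hφ ht.le s x
  have hm₂ := C.measurable_totalCost_right hψ ht.le s x
  refine C.lintegral_law_add_le t hm₁.ereal_toENNReal hm₁.neg.ereal_toENNReal
    hm₂.ereal_toENNReal hm₂.neg.ereal_toENNReal hp₁ hn₁ fun a ha₁ ha₂ => ?_
  -- With coordinate `t` frozen at `a`, the stage cost and the successor state and mode are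
  -- deterministic.
  have e : ∀ χ : PolicySeq n m K, ∀ ω, C.totalCost χ t s x (Function.update ω t a) =
      C.stageCost t s x (χ t s x) a.1 +
        C.totalCost χ (t + 1) (a.2 s) (C.dyn t s x (χ t s x) a.1) ω := fun χ ω => by
    rw [C.totalCost_of_lt χ ht, C.totalCost_update χ ht (Nat.lt_succ_self t),
      Function.update_self]
  simp only [e, hu] at ha₁ ha₂ ⊢
  obtain ⟨hadm, hbot, hle⟩ := htail (a.2 s) (C.dyn t s x (φ t s x) a.1)
  exact lintegral_add_le_of_expectation_le (C.measurable_totalCost_right hφ ht _ _)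
    (C.measurable_totalCost_right hψ ht _ _)
    (C.totalCost_ne_bot φ ht _ _) (C.totalCost_ne_bot ψ ht _ _)
    (C.stageCost_ne_bot _ _ _ _ _) ha₁ ha₂ hadm.2 hbot fun he => hle ⟨hφ, he⟩

theorem costToGo_le {t : ℕ} {s : Fin K} {x : Fin n → ℝ} {φ : PolicySeq n m K}
    (h : C.IsAdmissible t s x φ) : C.costToGo t s x ≤ C.expectedCost φ t s x :=
  iInf₂_le φ h

theorem expectedCost_congr {φ ψ : PolicySeq n m K} {t : ℕ} {s : Fin K} {x : Fin n → ℝ}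
    (h : ∀ ω, C.totalCost φ t s x ω = C.totalCost ψ t s x ω) :
    C.expectedCost φ t s x = C.expectedCost ψ t s x :=
  congrArg (expectation C.law) (funext h)

theorem isExtQuad_expectedCost {E : Type*} [AddCommGroup E] [Module ℝ E]
    (φ : E → PolicySeq n m K) (x : E → Fin n → ℝ) {t : ℕ} (ht : t ≤ C.horizon) (s : Fin K)
    (hquad : ∀ ω, IsExtQuad fun z => C.totalCost (φ z) t s (x z) ω)
    (hadm : ∀ z, C.IsAdmissible t s (x z) (φ z))
    (hbot : ∀ z, C.expectedCost (φ z) t s (x z) ≠ ⊥) :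
    IsExtQuad fun z => C.expectedCost (φ z) t s (x z) := by
  have hm : ∀ z, Measurable fun ω => C.totalCost (φ z) t s (x z) ω := fun z =>
    C.measurable_totalCost_right (hadm z).1 ht s (x z)
  have key := IsExtQuad.expectation (μ := C.law) hquad hm (fun z => (hadm z).2) hbot
  exact key

/-- The affine policies `gain`, `offset`, with the input at time `t` replaced by the constant
`u`. -/
noncomputable def constAt (gain : ℕ → Fin K → Matrix (Fin m) (Fin n) ℝ)
    (offset : ℕ → Fin K → Fin m → ℝ) (t : ℕ) (u : Fin m → ℝ) : PolicySeq n m K :=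
  affinePolicy (Function.update gain t 0) (Function.update offset t fun _ => u)

theorem affinePolicy_update_self (gain : ℕ → Fin K → Matrix (Fin m) (Fin n) ℝ)
    (offset : ℕ → Fin K → Fin m → ℝ) (t : ℕ) (L : Fin K → Matrix (Fin m) (Fin n) ℝ)
    (k : Fin K → Fin m → ℝ) (s : Fin K) (x : Fin n → ℝ) :
    affinePolicy (Function.update gain t L) (Function.update offset t k) t s x =
      L s *ᵥ x + k s := by
  simp [affinePolicy]

theorem affinePolicy_update_of_ne (gain : ℕ → Fin K → Matrix (Fin m) (Fin n) ℝ)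
    (offset : ℕ → Fin K → Fin m → ℝ) {t τ : ℕ} (h : τ ≠ t)
    (L : Fin K → Matrix (Fin m) (Fin n) ℝ) (k : Fin K → Fin m → ℝ) :
    affinePolicy (Function.update gain t L) (Function.update offset t k) τ =
      affinePolicy gain offset τ := by
  funext s x
  simp [affinePolicy, h]

theorem totalCost_update_policy (gain : ℕ → Fin K → Matrix (Fin m) (Fin n) ℝ)
    (offset : ℕ → Fin K → Fin m → ℝ) {t : ℕ} (ht : t < C.horizon)
    (L : Fin K → Matrix (Fin m) (Fin n) ℝ) (k : Fin K → Fin m → ℝ) (s : Fin K) (x : Fin n → ℝ)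
    (ω : (t : ℕ) → W t × (Fin K → Fin K)) :
    C.totalCost (affinePolicy (Function.update gain t L) (Function.update offset t k)) t s x ω =
      C.stageCost t s x (L s *ᵥ x + k s) (ω t).1 + C.totalCost (affinePolicy gain offset) (t + 1)
        ((ω t).2 s) (C.dyn t s x (L s *ᵥ x + k s) (ω t).1) ω := by
  rw [C.totalCost_of_lt _ ht, affinePolicy_update_self]
  congr 1
  exact C.totalCost_congr ht
    (fun τ hτ => affinePolicy_update_of_ne gain offset (by omega) L k) _ _ ω

/-- One step of dynamic programming: affine policies that are optimal after time `t` can be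
changed at time `t` so that they become optimal from time `t`. -/
theorem exists_affinePolicy_optimal_step
    (hdefined : ∀ (gain : ℕ → Fin K → Matrix (Fin m) (Fin n) ℝ) (offset : ℕ → Fin K → Fin m → ℝ),
      ∀ t ≤ C.horizon, ∀ s x,
        ExpectationExists C.law (C.totalCost (affinePolicy gain offset) t s x))
    (hbounded : ∀ t ≤ C.horizon, ∀ s x, C.costToGo t s x ≠ ⊥) {t : ℕ} (ht : t < C.horizon)
    (gain : ℕ → Fin K → Matrix (Fin m) (Fin n) ℝ) (offset : ℕ → Fin K → Fin m → ℝ)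
    (hopt : ∀ s x, C.expectedCost (affinePolicy gain offset) (t + 1) s x =
      C.costToGo (t + 1) s x) :
    ∃ (L : Fin K → Matrix (Fin m) (Fin n) ℝ) (k : Fin K → Fin m → ℝ), ∀ s x,
      C.expectedCost (affinePolicy (Function.update gain t L) (Function.update offset t k)) t s x =
        C.costToGo t s x := by
  have hadm : ∀ (gain : ℕ → Fin K → Matrix (Fin m) (Fin n) ℝ) (offset : ℕ → Fin K → Fin m → ℝ),
      ∀ t ≤ C.horizon, ∀ s x, C.IsAdmissible t s x (affinePolicy gain offset) :=
    fun gain offset t ht s x =>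
      ⟨measurable_affinePolicy gain offset, hdefined gain offset t ht s x⟩
  have hconst : ∀ u, ∀ t' ≤ C.horizon, ∀ s x,
      C.IsAdmissible t' s x (constAt gain offset t u) := fun u =>
    hadm (Function.update gain t 0) (Function.update offset t fun _ => u)
  have hle : ∀ s x u, C.costToGo t s x ≤ C.expectedCost (constAt gain offset t u) t s x :=
    fun s x u => C.costToGo_le (hconst u t ht.le s x)
  have hJ : ∀ s, IsExtQuad fun z : (Fin n → ℝ) × (Fin m → ℝ) =>
      C.expectedCost (constAt gain offset t z.2) t s z.1 := fun s => by
    have hq : ∀ ω, IsExtQuad fun z : (Fin n → ℝ) × (Fin m → ℝ) =>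
        C.totalCost (constAt gain offset t z.2) t s z.1 ω := fun ω => by
      simp only [constAt, C.totalCost_update_policy gain offset ht, Pi.zero_apply, zero_mulVec,
        zero_add]
      exact C.isExtQuad_stageCost_add
        (C.isExtQuad_totalCost gain offset ω ht ((ω t).2 s)) t s (ω t).1
    have hb : ∀ z : (Fin n → ℝ) × (Fin m → ℝ),
        C.expectedCost (constAt gain offset t z.2) t s z.1 ≠ ⊥ := fun z =>
      ne_bot_of_le_ne_bot (hbounded t ht.le s z.1) (hle s z.1 z.2)
    have hc : ∀ z : (Fin n → ℝ) × (Fin m → ℝ),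
        C.IsAdmissible t s z.1 (constAt gain offset t z.2) := fun z => hconst z.2 t ht.le s z.1
    have h := C.isExtQuad_expectedCost (fun z : (Fin n → ℝ) × (Fin m → ℝ) =>
      constAt gain offset t z.2) (fun z => z.1) ht.le s hq hc hb
    exact h
  choose L k hLk using fun s => (hJ s).exists_affine_argmin fun x => by
    rcases eq_or_ne (C.costToGo t s x) ⊤ with htop | htop
    -- Here every value of `J(x, ·)` is `⊤`, so any real number is a lower bound.
    · exact ⟨0, fun u => le_trans (by rw [htop]; exact le_top) (hle s x u)⟩
    · refine ⟨(C.costToGo t s x).toReal, fun u => le_trans ?_ (hle s x u)⟩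
      rw [EReal.coe_toReal htop (hbounded t ht.le s x)]
  refine ⟨fun s => LinearMap.toMatrix' (L s), k, fun s x => le_antisymm ?_
    (C.costToGo_le (hadm _ _ t ht.le s x))⟩
  have heq : C.expectedCost (affinePolicy (Function.update gain t fun s => LinearMap.toMatrix' (L s))
      (Function.update offset t k)) t s x =
      C.expectedCost (constAt gain offset t (L s x + k s)) t s x := by
    refine C.expectedCost_congr fun ω => ?_
    unfold constAt
    rw [C.totalCost_update_policy gain offset ht, C.totalCost_update_policy gain offset ht,
      LinearMap.toMatrix'_mulVec]
    simp only [Pi.zero_apply, zero_mulVec, zero_add]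
  rw [heq]
  -- For fixed `x` only the input `φ t s x` matters at time `t`, so `φ` is compared with that
  -- constant input followed by the affine tail.
  refine le_iInf₂ fun φ hφ => (hLk s x (φ t s x)).trans ?_
  refine C.expectedCost_le_of_tail hφ.1 (hconst _ t ht.le s x).1 ht ?_ hφ
    (ne_bot_of_le_ne_bot (hbounded t ht.le s x) (C.costToGo_le hφ)) (hconst _ t ht.le s x)
    (ne_bot_of_le_ne_bot (hbounded t ht.le s x) (hle s x _)) fun s' x' => ?_
  · unfold constAt
    rw [affinePolicy_update_self, Pi.zero_apply, zero_mulVec, zero_add]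
  · have e : C.expectedCost (constAt gain offset t (φ t s x)) (t + 1) s' x' =
        C.costToGo (t + 1) s' x' := by
      rw [← hopt]
      exact C.expectedCost_congr (C.totalCost_congr ht
        (fun τ hτ => affinePolicy_update_of_ne gain offset (by omega) _ _) s' x')
    exact ⟨hconst _ (t + 1) ht s' x', e.trans_ne (hbounded (t + 1) ht s' x'),
      fun h => e.trans_le (C.costToGo_le h)⟩

theorem exists_affinePolicy_optimal
    (hdefined : ∀ (gain : ℕ → Fin K → Matrix (Fin m) (Fin n) ℝ) (offset : ℕ → Fin K → Fin m → ℝ),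
      ∀ t ≤ C.horizon, ∀ s x,
        ExpectationExists C.law (C.totalCost (affinePolicy gain offset) t s x))
    (hbounded : ∀ t ≤ C.horizon, ∀ s x, C.costToGo t s x ≠ ⊥) {t : ℕ} (ht : t ≤ C.horizon) :
    ∃ (gain : ℕ → Fin K → Matrix (Fin m) (Fin n) ℝ) (offset : ℕ → Fin K → Fin m → ℝ),
      ∀ τ, t ≤ τ → τ ≤ C.horizon → ∀ s x,
        C.expectedCost (affinePolicy gain offset) τ s x = C.costToGo τ s x := by
  refine backward_induction (motive := fun t =>
    ∃ (gain : ℕ → Fin K → Matrix (Fin m) (Fin n) ℝ) (offset : ℕ → Fin K → Fin m → ℝ),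
      ∀ τ, t ≤ τ → τ ≤ C.horizon → ∀ s x,
        C.expectedCost (affinePolicy gain offset) τ s x = C.costToGo τ s x) ?_ ?_ ht
  -- At the horizon no input is applied, so any policy will do.
  · refine ⟨0, 0, fun τ h₁ h₂ s x => ?_⟩
    obtain rfl := le_antisymm h₂ h₁
    refine le_antisymm (le_iInf₂ fun φ _ => (C.expectedCost_congr fun ω => ?_).le)
      (C.costToGo_le ⟨measurable_affinePolicy 0 0, hdefined 0 0 _ le_rfl s x⟩)
    rw [totalCost_horizon, totalCost_horizon]
  · rintro t ht ⟨gain, offset, h⟩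
    obtain ⟨L, k, hLk⟩ := C.exists_affinePolicy_optimal_step hdefined hbounded ht gain offset
      (h (t + 1) le_rfl ht)
    refine ⟨Function.update gain t L, Function.update offset t k, fun τ h₁ h₂ s x => ?_⟩
    rcases h₁.eq_or_lt with rfl | hlt
    · exact hLk s x
    · rw [← h τ hlt h₂]
      exact C.expectedCost_congr (C.totalCost_congr h₂
        (fun σ hσ => affinePolicy_update_of_ne gain offset (by omega) _ _) s x)

end ExtQuadControl

theorem mainTheorem2 {n m K : ℕ} {W : ℕ → Type*} [∀ t, MeasurableSpace (W t)]
    (C : ExtQuadControl n m K W)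
    -- no undefined cost: the expected cost of every affine policy exists
    (hdefined : ∀ (gain : ℕ → Fin K → Matrix (Fin m) (Fin n) ℝ) (offset : ℕ → Fin K → Fin m → ℝ),
      ∀ t ≤ C.horizon, ∀ s x,
        ExpectationExists C.law (C.totalCost (affinePolicy gain offset) t s x))
    -- no cost that is unbounded below
    (hbounded : ∀ t ≤ C.horizon, ∀ s x, C.costToGo t s x ≠ ⊥) :
    (∀ t ≤ C.horizon, ∀ s, IsExtendedQuadratic (C.costToGo t s)) ∧
    ∃ (gain : ℕ → Fin K → Matrix (Fin m) (Fin n) ℝ) (offset : ℕ → Fin K → Fin m → ℝ),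
      C.IsOptimal (affinePolicy gain offset) := by
  obtain ⟨gain, offset, hopt⟩ := C.exists_affinePolicy_optimal hdefined hbounded C.horizon.zero_le
  refine ⟨fun t ht s => ?_, gain, offset, fun t ht s x =>
    ⟨⟨ExtQuadControl.measurable_affinePolicy gain offset, hdefined gain offset t ht s x⟩,
      hopt t t.zero_le ht s x⟩⟩
  refine IsExtQuad.isExtendedQuadratic ?_
  -- The cost-to-go inherits its form from the expected cost of the optimal affine policies.
  have e : C.costToGo t s = fun x => C.expectedCost (affinePolicy gain offset) t s x :=
    funext fun x => (hopt t t.zero_le ht s x).symm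
  rw [e]
  have hadm : ∀ x, C.IsAdmissible t s x (affinePolicy gain offset) := fun x =>
    ⟨ExtQuadControl.measurable_affinePolicy gain offset, hdefined gain offset t ht s x⟩
  have hbot : ∀ x, C.expectedCost (affinePolicy gain offset) t s x ≠ ⊥ := fun x =>
    (hopt t t.zero_le ht s x).trans_ne (hbounded t ht s x)
  have h := C.isExtQuad_expectedCost (fun _ => affinePolicy gain offset) (fun x => x) ht s
    (fun ω => C.isExtQuad_totalCost gain offset ω ht s) hadm hbot
  exact h
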